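/- Let $\|\cdot\|$ be the Euclidean norm. An \emph{extension} of a finite multiset $P\subset\mathbb R^d$ is a multiset $P'\subset\mathbb R^{d+1}$ obtained by appending to every copy of every point $p\in P$ a real last coordinate $p'$ (different copies of the same point may get different values). For a finite multiset $X\subset\mathbb R^{d+1}$ let $\mu^z_0(X)$ be any minimizer of $s\mapsto\sum_{x\in X}\|x-s\|^z$ over all $s\in\mathbb R^{d+1}$ with last coordinate $0$. There are an absolute constant $A$ and one deterministic real-RAM algorithm (exact real arithmetic $+,-,\times,/,\sqrt{\cdot}$ and comparisons, and arithmetic and addressing on natural numbers, at unit cost) such that the following holds for all integers $T\ge 2$, $d\ge 0$, $z\ge 1$, all real $0<\varepsilon<1$, and every finite multiset $P\subset\mathbb R^d$ with at most $T$ distinct points. Given $d$, $z$, $\varepsilon$ and the list of the distinct points of $P$, the algorithm outputs within $(d+1)\cdot T^{A^z\varepsilon^{-2}}$ steps a finite set $\mathcal N\subset\mathbb R^d$ with $$|\mathcal N|\le T^{A^z\varepsilon^{-2}}$$ (so, for fixed $z$, size $T^{O(\varepsilon^{-2})}$ and time $O(d)\cdot T^{O(\varepsilon^{-2})}$) such that: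 for every $m$ and every linear map $\Pi:\mathbb R^d\to\mathbb R^m$ with $$(1-\varepsilon/z)\|x-y\|\le\|\Pi x-\Pi y\|\le(1+\varepsilon/z)\|x-y\|\qquad\text{for all }x,y\in\mathcal N,$$ for every extension $P'$ of $P$ and every sub-multiset $C'\subseteq P'$, writing $\Pi'(C')$ for the multiset of all $(\Pi p,p')$ with $(p,p')\in C'$, the minimizers $\mu_0^z(C')$ and $\mu_0^z(\Pi'(C'))$ exist and, for every choice of them, $$(1-2\varepsilon)\sum_{(p,p')\in C'}\bigl\|(p,p')-\mu^z_0(C')\bigr\|^z\;\le\;\sum_{(p,p')\in C'}\bigl\|(\Pi p,p')-\mu^z_0(\Pi'(C'))\bigr\|^z\;\le\;(1+2\varepsilon)\sum_{(p,p')\in C'}\bigl\|(p,p')-\mu^z_0(C')\bigr\|^z .$$ -/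

import Mathlib

/-! ## A real RAM: structured programs with unit-cost arithmetic -/

namespace RealRAM

/-- A memory: countably many arrays of natural numbers (used for counting and addressing) and
countably many arrays of exact real numbers. -/
structure Mem where
  nat : ℕ → ℕ → ℕ
  real : ℕ → ℕ → ℝ

/-- Expressions with natural values. `load a i` reads cell `i` of the array number `a`;
`sub` is truncated subtraction. -/
inductive NExp where
  | const (n : ℕ)
  | load (a : ℕ) (i : NExp)
  | add (e₁ e₂ : NExp)
  | sub (e₁ e₂ : NExp)
  | mul (e₁ e₂ : NExp)

/-- Expressions with real values. There are no real constants besides natural numbers.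
Division by zero and square roots of negative numbers return `0`. -/
inductive RExp where
  | ofNat (e : NExp)
  | load (a : ℕ) (i : NExp)
  | add (e₁ e₂ : RExp)
  | sub (e₁ e₂ : RExp)
  | mul (e₁ e₂ : RExp)
  | div (e₁ e₂ : RExp)
  | sqrt (e : RExp)

/-- Tests: strict comparisons of naturals and of reals, negation, conjunction. -/
inductive Test where
  | natLt (e₁ e₂ : NExp)
  | realLt (e₁ e₂ : RExp)
  | not (b : Test)
  | and (b₁ b₂ : Test)

namespace NExp

def eval (s : Mem) : NExp → ℕ
  | const n => n
  | load a i => s.nat a (i.eval s)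
  | add e₁ e₂ => e₁.eval s + e₂.eval s
  | sub e₁ e₂ => e₁.eval s - e₂.eval s
  | mul e₁ e₂ => e₁.eval s * e₂.eval s

/-- Number of elementary operations for evaluating the expression. -/
def time : NExp → ℕ
  | const _ => 1
  | load _ i => i.time + 1
  | add e₁ e₂ => e₁.time + e₂.time + 1
  | sub e₁ e₂ => e₁.time + e₂.time + 1
  | mul e₁ e₂ => e₁.time + e₂.time + 1

end NExp

namespace RExp

noncomputable def eval (s : Mem) : RExp → ℝ
  | ofNat e => (e.eval s : ℝ)
  | load a i => s.real a (i.eval s)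
  | add e₁ e₂ => e₁.eval s + e₂.eval s
  | sub e₁ e₂ => e₁.eval s - e₂.eval s
  | mul e₁ e₂ => e₁.eval s * e₂.eval s
  | div e₁ e₂ => e₁.eval s / e₂.eval s
  | sqrt e => Real.sqrt (e.eval s)

/-- Number of elementary operations for evaluating the expression. -/
def time : RExp → ℕ
  | ofNat e => e.time + 1
  | load _ i => i.time + 1
  | add e₁ e₂ => e₁.time + e₂.time + 1
  | sub e₁ e₂ => e₁.time + e₂.time + 1
  | mul e₁ e₂ => e₁.time + e₂.time + 1
  | div e₁ e₂ => e₁.time + e₂.time + 1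
  | sqrt e => e.time + 1

end RExp

namespace Test

def holds (s : Mem) : Test → Prop
  | natLt e₁ e₂ => e₁.eval s < e₂.eval s
  | realLt e₁ e₂ => e₁.eval s < e₂.eval s
  | not b => ¬ b.holds s
  | and b₁ b₂ => b₁.holds s ∧ b₂.holds s

/-- Number of elementary operations for evaluating the test. -/
def time : Test → ℕ
  | natLt e₁ e₂ => e₁.time + e₂.time + 1
  | realLt e₁ e₂ => e₁.time + e₂.time + 1
  | not b => b.time + 1
  | and b₁ b₂ => b₁.time + b₂.time + 1

end Test

/-- Programs. `setNat a i e` and `setReal a i e` store the value of `e` in cell `i` of the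
natural, respectively real, array number `a`. -/
inductive Prog where
  | skip
  | setNat (a : ℕ) (i : NExp) (e : NExp)
  | setReal (a : ℕ) (i : NExp) (e : RExp)
  | seq (p q : Prog)
  | cond (b : Test) (p q : Prog)
  | loop (b : Test) (p : Prog)

/-- The memory after storing `v` in cell `i` of the natural array `a`. -/
def Mem.writeNat (s : Mem) (a i v : ℕ) : Mem :=
  { s with nat := Function.update s.nat a (Function.update (s.nat a) i v) }

/-- The memory after storing `v` in cell `i` of the real array `a`. -/
def Mem.writeReal (s : Mem) (a i : ℕ) (v : ℝ) : Mem :=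
  { s with real := Function.update s.real a (Function.update (s.real a) i v) }

/-- `Exec p s t s'`: started in memory `s`, the program `p` halts after exactly `t` elementary
steps, in memory `s'`. `loop b p` is "while `b` do `p`". -/
inductive Exec : Prog → Mem → ℕ → Mem → Prop where
  | skip (s : Mem) : Exec .skip s 1 s
  | setNat (s : Mem) (a : ℕ) (i e : NExp) :
      Exec (.setNat a i e) s (i.time + e.time + 1) (s.writeNat a (i.eval s) (e.eval s))
  | setReal (s : Mem) (a : ℕ) (i : NExp) (e : RExp) :
      Exec (.setReal a i e) s (i.time + e.time + 1) (s.writeReal a (i.eval s) (e.eval s))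
  | seq {p q : Prog} {s s₁ s₂ : Mem} {t₁ t₂ : ℕ} :
      Exec p s t₁ s₁ → Exec q s₁ t₂ s₂ → Exec (.seq p q) s (t₁ + t₂) s₂
  | condTrue {b : Test} {p q : Prog} {s s₁ : Mem} {t : ℕ} :
      b.holds s → Exec p s t s₁ → Exec (.cond b p q) s (b.time + t) s₁
  | condFalse {b : Test} {p q : Prog} {s s₁ : Mem} {t : ℕ} :
      ¬ b.holds s → Exec q s t s₁ → Exec (.cond b p q) s (b.time + t) s₁
  | loopFalse {b : Test} {p : Prog} {s : Mem} :
      ¬ b.holds s → Exec (.loop b p) s b.time s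
  | loopTrue {b : Test} {p : Prog} {s s₁ s₂ : Mem} {t₁ t₂ : ℕ} :
      b.holds s → Exec p s t₁ s₁ → Exec (.loop b p) s₁ t₂ s₂ →
      Exec (.loop b p) s (b.time + t₁ + t₂) s₂

end RealRAM

/-! ## Clustering with extension coordinates -/

namespace Clustering

/-- Euclidean space of dimension `d`. -/
abbrev E (d : ℕ) : Type := EuclideanSpace ℝ (Fin d)

/-- Euclidean space of dimension `d + 1`, the last coordinate being the extension coordinate. -/
abbrev EExt (d : ℕ) : Type := WithLp 2 (E d × ℝ)

/-- The point `p` with extension coordinate `h`. -/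
def zext {d : ℕ} (p : E d) (h : ℝ) : EExt d := WithLp.toLp 2 (p, h)

/-- `cost^z(X, {s})`. -/
noncomputable def cost {d : ℕ} (z : ℕ) (X : Multiset (EExt d)) (s : EExt d) : ℝ :=
  (X.map fun x => dist x s ^ z).sum

/-- `s` is an optimal `(1,z)`-center of `X` among the points with extension coordinate `0`
(an element of the argmin that defines `μ₀^z(X)`). -/
def IsCenterZero {d : ℕ} (z : ℕ) (X : Multiset (EExt d)) (s : EExt d) : Prop :=
  s.snd = 0 ∧ ∀ s' : EExt d, s'.snd = 0 → cost z X s ≤ cost z X s'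

/-- `P'` is an extension of the multiset `P`: every point of `P` (with multiplicity) receives an
extension coordinate; copies of the same point may receive different ones. -/
def IsExtension {d : ℕ} (P : Multiset (E d)) (P' : Multiset (EExt d)) : Prop :=
  P'.map (fun x => x.fst) = P

/-- The image of a multiset of extended points under a linear map that acts on the first
coordinates and keeps the extension coordinates. -/
def mapExt {d m : ℕ} (Φ : E d →ₗ[ℝ] E m) (X : Multiset (EExt d)) : Multiset (EExt m) :=
  X.map fun x => zext (Φ x.fst) x.snd

/-- `Φ` preserves the pairwise distances in `N` up to a factor `1 ± δ`. -/
def PreservesDist {d m : ℕ} (Φ : E d →ₗ[ℝ] E m) (N : Set (E d)) (δ : ℝ) : Prop :=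
  ∀ x ∈ N, ∀ y ∈ N,
    (1 - δ) * dist x y ≤ dist (Φ x) (Φ y) ∧ dist (Φ x) (Φ y) ≤ (1 + δ) * dist x y

/-- `L` lists the distinct points of the multiset `P`, each once. -/
def IsListing {d : ℕ} (L : List (E d)) (P : Multiset (E d)) : Prop :=
  L.Nodup ∧ ∀ x, x ∈ L ↔ x ∈ P

/-- The initial memory for the input `(d, z, ε, L)`. Natural array `0` holds `d`, the number of
points of `L`, and `z`; real array `0` holds `ε`; real array `1` holds the points of `L`, the
`j`-th coordinate of the `i`-th point in cell `i * d + j`; every other cell holds `0`. -/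
noncomputable def inputMem {d : ℕ} (z : ℕ) (ε : ℝ) (L : List (E d)) : RealRAM.Mem where
  nat a i :=
    if a = 0 then (if i = 0 then d else if i = 1 then L.length else if i = 2 then z else 0) else 0
  real a i :=
    if a = 0 then (if i = 0 then ε else 0)
    else if a = 1 then
      (if h : i / d < L.length ∧ 0 < d then (L.get ⟨i / d, h.1⟩) ⟨i % d, Nat.mod_lt i h.2⟩ else 0)
    else 0

/-- The set of points that a final memory represents: cell `0` of natural array `1` holds the
number of points, and real array `2` holds the points, the `j`-th coordinate of the `i`-th point
in cell `i * d + j`. -/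
def outputSet (d : ℕ) (s : RealRAM.Mem) : Set (E d) :=
  {x | ∃ i < s.nat 1 0, ∀ j : Fin d, x j = s.real 2 (i * d + j)}

end Clustering

/-!
For the lower bound, a linear map that shrinks the distances in `P` by a factor at least `1 - δ` has
an inverse on the image of `P` with Lipschitz constant `(1 - δ)⁻¹`. By the one-point case of
Kirszbraun's theorem this inverse extends to the center of the image, so some center costs for `C'`
at most `(1 - δ)⁻¹ ^ z` times as much.

For the upper bound, it suffices that every center `c` has a substitute `s` in the net with
`dist p s ≤ (1 + δ) * dist p c` for all `p` in `P`, because the image of `s` is then a good center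
for the image of `C'`. Let `R` be the distance from `c` to `P`. Either the nearest point `s₀` of `P`
is a substitute, or some `q` in `P` has a distance to `s₀` between `R` and `2 * R / δ`. In the
second case halve this distance until it is a step size `η` between `δ * R / 2` and `δ * R`, and
walk from `s₀` by steps of length `η`, each towards a point of `P` that violates
`dist p s ≤ dist p c + η`. Every step lowers the squared distance to `c` by at least `η ^ 2`, so
that at most `4 / δ ^ 2` steps are needed.

The moves "jump to `p`", "halve the step size" and "step towards `p`" do not mention `c`. Hence the
points reached by `O(δ⁻²)` moves form a net, and it can be enumerated as a search tree in which
every node has three children for each point of `P`.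
-/

namespace Clustering

/-! ## One-point extension of Lipschitz maps -/

section OnePointExtension

variable {ι F G : Type*} [Fintype ι] [NormedAddCommGroup F] [InnerProductSpace ℝ F]
  [NormedAddCommGroup G] [InnerProductSpace ℝ G]

theorem sum_mul_norm_sub_sq {w : ι → ℝ} (hw : ∑ i, w i = 1) (v : ι → F) (a : F) :
    ∑ i, w i * ‖v i - a‖ ^ 2
      = ∑ i, w i * ‖v i‖ ^ 2 - 2 * inner ℝ (∑ i, w i • v i) a + ‖a‖ ^ 2 := by
  simp only [norm_sub_sq_real, mul_add, mul_sub, Finset.sum_add_distrib, Finset.sum_sub_distrib,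
    ← Finset.sum_mul, hw, one_mul, sum_inner, real_inner_smul_left, Finset.mul_sum]
  congr! 3
  ring

theorem sum_sum_mul_norm_sub_sq {w : ι → ℝ} (hw : ∑ i, w i = 1) (v : ι → F) :
    ∑ j, ∑ i, w j * w i * ‖v i - v j‖ ^ 2 = 2 * ∑ i, w i * ‖v i - ∑ j, w j • v j‖ ^ 2 := by
  set b := ∑ j, w j • v j with hb
  have hinner : ∑ j, w j * inner ℝ b (v j) = ‖b‖ ^ 2 := by
    simp only [← real_inner_smul_right, ← inner_sum, ← hb, real_inner_self_eq_norm_sq]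
  calc ∑ j, ∑ i, w j * w i * ‖v i - v j‖ ^ 2
      = ∑ j, w j * (∑ i, w i * ‖v i‖ ^ 2 - 2 * inner ℝ b (v j) + ‖v j‖ ^ 2) := by
        simp only [mul_assoc, ← Finset.mul_sum, sum_mul_norm_sub_sq hw v, hb]
    _ = 2 * (∑ i, w i * ‖v i‖ ^ 2 - ‖b‖ ^ 2) := by
        simp only [mul_add, mul_sub, Finset.sum_add_distrib, Finset.sum_sub_distrib,
          ← Finset.sum_mul, hw, mul_left_comm _ (2 : ℝ), ← Finset.mul_sum, hinner]
        ring
    _ = 2 * ∑ i, w i * ‖v i - b‖ ^ 2 := by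
        rw [sum_mul_norm_sub_sq hw v b, ← hb, real_inner_self_eq_norm_sq]
        ring

theorem sum_mul_norm_sub_barycenter_sq_le {w : ι → ℝ} (hw : ∑ i, w i = 1) (v : ι → F) (a : F) :
    ∑ i, w i * ‖v i - ∑ j, w j • v j‖ ^ 2 ≤ ∑ i, w i * ‖v i - a‖ ^ 2 := by
  rw [sum_mul_norm_sub_sq hw v, sum_mul_norm_sub_sq hw v, real_inner_self_eq_norm_sq]
  have := norm_sub_sq_real (∑ j, w j • v j) a
  linarith [sq_nonneg ‖∑ j, w j • v j - a‖]

/-- The minimax theorem for the functions `b ↦ ‖y i - b‖ ^ 2 - ρ i`. -/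
theorem exists_mem_stdSimplex_norm_sub_barycenter_sq_le [Nonempty ι] (y : ι → G) (ρ : ι → ℝ) :
    ∃ w ∈ stdSimplex ℝ ι, ∀ i, ‖y i - ∑ j, w j • y j‖ ^ 2 - ρ i
      ≤ ∑ k, w k * (‖y k - ∑ j, w j • y j‖ ^ 2 - ρ k) := by
  classical
  let bary := (Fintype.linearCombination ℝ y).toContinuousLinearMap
  let lin := (Fintype.linearCombination ℝ fun i => ‖y i‖ ^ 2 - ρ i).toContinuousLinearMap
  -- The dual objective is concave; the claim is its first-order condition at a maximizer.
  let dual : (ι → ℝ) → ℝ := fun w => lin w - ‖bary w‖ ^ 2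
  obtain ⟨w, hw, hmax⟩ := (isCompact_stdSimplex (𝕜 := ℝ) (ι := ι)).exists_isMaxOn
    ⟨_, single_mem_stdSimplex ℝ (Classical.arbitrary ι)⟩
    (show ContinuousOn dual _ by fun_prop)
  have hderiv : HasFDerivAt dual (lin - (2 : ℕ) • (innerSL ℝ (bary w)).comp bary) w :=
    lin.hasFDerivAt.sub bary.hasFDerivAt.norm_sq
  have hbary : bary w = ∑ j, w j • y j := Fintype.linearCombination_apply ..
  have hlin : lin w = ∑ j, w j * (‖y j‖ ^ 2 - ρ j) := Fintype.linearCombination_apply ..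
  refine ⟨w, hw, fun i => ?_⟩
  have hfirst := hmax.localize.hasFDerivWithinAt_nonpos hderiv.hasFDerivWithinAt
    (sub_mem_posTangentConeAt_of_segment_subset
      ((convex_stdSimplex ℝ ι).segment_subset hw (single_mem_stdSimplex ℝ i)))
  have hbary_i : bary (Pi.single i 1) = y i := by simp [bary]
  have hlin_i : lin (Pi.single i 1) = ‖y i‖ ^ 2 - ρ i := by simp [lin]
  have hvalue : ∑ k, w k * (‖y k - bary w‖ ^ 2 - ρ k) = lin w - ‖bary w‖ ^ 2 := by
    simp only [hlin, mul_sub, Finset.sum_sub_distrib]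
    rw [sum_mul_norm_sub_sq hw.2 y, ← hbary, real_inner_self_eq_norm_sq]
    ring
  simp only [sub_apply, smul_apply, ContinuousLinearMap.comp_apply, innerSL_apply_apply, map_sub,
    hbary_i, hlin_i, nsmul_eq_mul, real_inner_self_eq_norm_sq, Nat.cast_ofNat] at hfirst
  rw [← hbary, hvalue, norm_sub_sq_real, real_inner_comm]
  linarith

/-- The one-point case of Kirszbraun's theorem. -/
theorem exists_dist_le_of_forall_dist_le {ι : Type*} [Finite ι] {K : ℝ} (hK : 0 ≤ K)
    {x : ι → F} {y : ι → G} (h : ∀ i j, dist (y i) (y j) ≤ K * dist (x i) (x j)) (a : F) :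
    ∃ b, ∀ i, dist (y i) b ≤ K * dist (x i) a := by
  have := Fintype.ofFinite ι
  cases isEmpty_or_nonempty ι
  · exact ⟨0, isEmptyElim⟩
  obtain ⟨w, ⟨hw0, hw1⟩, hb⟩ :=
    exists_mem_stdSimplex_norm_sub_barycenter_sq_le y fun i => (K * ‖x i - a‖) ^ 2
  refine ⟨∑ j, w j • y j, fun i => ?_⟩
  simp only [dist_eq_norm] at h ⊢
  have hvar : ∑ j, ∑ i, w j * w i * ‖y i - y j‖ ^ 2
      ≤ K ^ 2 * ∑ j, ∑ i, w j * w i * ‖x i - x j‖ ^ 2 := by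
    simp only [Finset.mul_sum]
    refine Finset.sum_le_sum fun j _ => Finset.sum_le_sum fun i _ => ?_
    calc w j * w i * ‖y i - y j‖ ^ 2 ≤ w j * w i * (K * ‖x i - x j‖) ^ 2 := by
          gcongr
          exacts [mul_nonneg (hw0 j) (hw0 i), h i j]
      _ = _ := by ring
  have hmean : ∑ k, w k * ‖y k - ∑ j, w j • y j‖ ^ 2 ≤ K ^ 2 * ∑ k, w k * ‖x k - a‖ ^ 2 := by
    rw [sum_sum_mul_norm_sub_sq hw1, sum_sum_mul_norm_sub_sq hw1] at hvar
    nlinarith [sum_mul_norm_sub_barycenter_sq_le hw1 x a, sq_nonneg K]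
  refine le_of_sq_le_sq ?_ (by positivity)
  have := hb i
  simp only [mul_sub, Finset.sum_sub_distrib, mul_pow, mul_left_comm (w _), ← Finset.mul_sum]
    at this
  linarith [mul_pow K ‖x i - a‖ 2]

end OnePointExtension

/-! ## Costs of extensions -/

theorem dist_zext {d : ℕ} (p c : E d) (h : ℝ) :
    dist (zext p h) (zext c 0) = √(dist p c ^ 2 + h ^ 2) := by
  rw [WithLp.prod_dist_eq_of_L2]
  simp [zext]

theorem dist_le_dist_zext {d : ℕ} (p c : E d) (h : ℝ) :
    dist p c ≤ dist (zext p h) (zext c 0) := by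
  rw [dist_zext]
  exact Real.le_sqrt_of_sq_le (le_add_of_nonneg_right (sq_nonneg h))

theorem dist_zext_le {d m : ℕ} {p c : E d} {p' c' : E m} {K : ℝ} (hK : 1 ≤ K)
    (hdist : dist p c ≤ K * dist p' c') (h : ℝ) :
    dist (zext p h) (zext c 0) ≤ K * dist (zext p' h) (zext c' 0) := by
  rw [dist_zext, dist_zext, Real.sqrt_le_left (by positivity), mul_pow,
    Real.sq_sqrt (by positivity), mul_add]
  refine add_le_add ?_ (le_mul_of_one_le_left (sq_nonneg h) (one_le_pow₀ hK))
  rw [← mul_pow]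
  exact pow_le_pow_left₀ dist_nonneg hdist 2

theorem eq_zext_of_snd_eq_zero {d : ℕ} {c : EExt d} (hc : c.snd = 0) : c = zext c.fst 0 := by
  rw [← hc]; rfl

theorem cost_nonneg {d z : ℕ} (X : Multiset (EExt d)) (s : EExt d) : 0 ≤ cost z X s :=
  Multiset.sum_nonneg (by simp only [Multiset.mem_map]; rintro _ ⟨x, -, rfl⟩; positivity)

theorem dist_pow_le_cost {d : ℕ} (z : ℕ) {X : Multiset (EExt d)} {x : EExt d} (hx : x ∈ X)
    (s : EExt d) : dist x s ^ z ≤ cost z X s :=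
  Multiset.single_le_sum (by simp only [Multiset.mem_map]; rintro _ ⟨x, -, rfl⟩; positivity) _
    (Multiset.mem_map_of_mem (fun x => dist x s ^ z) hx)

theorem cost_map_le_cost_map {α : Type*} {d m z : ℕ} {K : ℝ} {X : Multiset α} {f : α → EExt d}
    {g : α → EExt m} {s : EExt d} {s' : EExt m}
    (h : ∀ x ∈ X, dist (f x) s ≤ K * dist (g x) s') :
    cost z (X.map f) s ≤ K ^ z * cost z (X.map g) s' := by
  rw [cost, cost, Multiset.map_map, Multiset.map_map, ← Multiset.sum_map_mul_left]
  refine Multiset.sum_map_le_sum_map _ _ fun x hx => ?_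
  rw [Function.comp_apply, Function.comp_apply, ← mul_pow]
  exact pow_le_pow_left₀ dist_nonneg (h x hx) z

theorem exists_isCenterZero {d z : ℕ} (hz : z ≠ 0) (X : Multiset (EExt d)) :
    ∃ c, IsCenterZero z X c := by
  obtain rfl | ⟨x₀, hx₀⟩ := X.empty_or_exists_mem
  · exact ⟨zext 0 0, rfl, fun _ _ => by simp [cost]⟩
  have hcont : Continuous fun y : E d => cost z X (zext y 0) :=
    continuous_multiset_sum _ fun x _ => by unfold zext; fun_prop
  have hcoercive : ∀ y, dist y x₀.fst ^ z ≤ cost z X (zext y 0) := fun y => by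
    refine le_trans (pow_le_pow_left₀ dist_nonneg ?_ z) (dist_pow_le_cost z hx₀ _)
    rw [dist_comm]
    exact dist_le_dist_zext x₀.fst y x₀.snd
  obtain ⟨y, hy⟩ := hcont.exists_forall_le (Filter.tendsto_atTop_mono hcoercive
    ((Filter.tendsto_pow_atTop hz).comp (tendsto_dist_right_cocompact_atTop x₀.fst)))
  refine ⟨zext y 0, rfl, fun s hs => ?_⟩
  rw [eq_zext_of_snd_eq_zero hs]
  exact hy _

/-! ## Preservation of costs -/

/-- `N` is a `(1 + δ)`-approximate center net of `S`: it contains `S`, and every point of the space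
has a substitute in `N` whose distance to each point of `S` is larger by a factor at most
`1 + δ`. -/
structure IsCenterNet {F : Type*} [PseudoMetricSpace F] (δ : ℝ) (S N : Set F) : Prop where
  subset : S ⊆ N
  exists_dist_le : ∀ c, ∃ s ∈ N, ∀ p ∈ S, dist p s ≤ (1 + δ) * dist p c

theorem mul_cost_le_cost_mapExt {d m z : ℕ} {δ : ℝ} (hδ₀ : 0 ≤ δ) (hδ₁ : δ < 1) {S : Set (E d)}
    (hS : S.Finite) {Φ : E d →ₗ[ℝ] E m} (hΦ : PreservesDist Φ S δ) {X : Multiset (EExt d)}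
    (hX : ∀ x ∈ X, x.fst ∈ S) {c : EExt d} (hc : IsCenterZero z X c) {cΦ : EExt m}
    (hcΦ : cΦ.snd = 0) : (1 - δ) ^ z * cost z X c ≤ cost z (mapExt Φ X) cΦ := by
  have hpos : 0 < 1 - δ := sub_pos.2 hδ₁
  have := hS.to_subtype
  obtain ⟨b, hb⟩ := exists_dist_le_of_forall_dist_le
    (x := fun p : S => Φ p) (y := fun p : S => (p : E d)) (inv_nonneg.2 hpos.le)
    (fun p q => (le_inv_mul_iff₀ hpos).2 (hΦ p p.2 q q.2).1) cΦ.fst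
  rw [← le_inv_mul_iff₀ (pow_pos hpos z), ← inv_pow]
  calc cost z X c ≤ cost z (X.map id) (zext b 0) := by
        rw [Multiset.map_id]; exact hc.2 _ rfl
    _ ≤ (1 - δ)⁻¹ ^ z * cost z (mapExt Φ X) (zext cΦ.fst 0) :=
        cost_map_le_cost_map fun x hx => dist_zext_le
          ((one_le_inv₀ hpos).2 (sub_le_self 1 hδ₀)) (hb ⟨x.fst, hX x hx⟩) x.snd
    _ = _ := by rw [← eq_zext_of_snd_eq_zero hcΦ]

theorem cost_mapExt_le_mul_cost {d m z : ℕ} {δ η : ℝ} (hδ : 0 ≤ δ) (hη : 0 ≤ η) {S N : Set (E d)}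
    (hN : IsCenterNet η S N) {Φ : E d →ₗ[ℝ] E m} (hΦ : PreservesDist Φ N δ)
    {X : Multiset (EExt d)} (hX : ∀ x ∈ X, x.fst ∈ S) {c : EExt d} (hc : c.snd = 0) {cΦ : EExt m}
    (hcΦ : IsCenterZero z (mapExt Φ X) cΦ) :
    cost z (mapExt Φ X) cΦ ≤ ((1 + δ) * (1 + η)) ^ z * cost z X c := by
  obtain ⟨s, hsN, hs⟩ := hN.exists_dist_le c.fst
  have hdist : ∀ x ∈ X, dist (Φ x.fst) (Φ s) ≤ (1 + δ) * (1 + η) * dist x.fst c.fst := fun x hx =>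
    calc dist (Φ x.fst) (Φ s) ≤ (1 + δ) * dist x.fst s := (hΦ _ (hN.subset (hX x hx)) _ hsN).2
      _ ≤ (1 + δ) * ((1 + η) * dist x.fst c.fst) := by gcongr; exact hs _ (hX x hx)
      _ = _ := (mul_assoc ..).symm
  calc cost z (mapExt Φ X) cΦ ≤ cost z (mapExt Φ X) (zext (Φ s) 0) := hcΦ.2 _ rfl
    _ ≤ ((1 + δ) * (1 + η)) ^ z * cost z (X.map id) (zext c.fst 0) :=
        cost_map_le_cost_map fun x hx => dist_zext_le
          (one_le_mul_of_one_le_of_one_le (by linarith) (by linarith)) (hdist x hx) x.snd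
    _ = _ := by rw [Multiset.map_id, ← eq_zext_of_snd_eq_zero hc]

theorem one_sub_le_one_sub_div_pow {z : ℕ} (hz : 1 ≤ z) {ε : ℝ} (hε : ε ≤ 1) :
    1 - ε ≤ (1 - ε / z) ^ z := by
  have hz' : (1 : ℝ) ≤ z := mod_cast hz
  have hle : ε / z ≤ 1 := div_le_one_of_le₀ (hε.trans hz') (by positivity)
  have := one_add_mul_le_pow (a := -(ε / z)) (by linarith) z
  rwa [mul_neg, mul_div_cancel₀ _ (by positivity), ← sub_eq_add_neg, ← sub_eq_add_neg] at this

theorem exp_seventeen_sixteenths_le : Real.exp (17 / 16) ≤ 3 := by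
  have hsmall : Real.exp (1 / 16) ≤ 1 / (1 - 1 / 16) :=
    Real.exp_bound_div_one_sub_of_interval (by norm_num) (by norm_num)
  calc Real.exp (17 / 16) = Real.exp 1 * Real.exp (1 / 16) := by rw [← Real.exp_add]; norm_num
    _ ≤ 2.7182818286 * (1 / (1 - 1 / 16)) := by gcongr; exact Real.exp_one_lt_d9.le
    _ ≤ 3 := by norm_num

theorem one_add_div_mul_one_add_div_pow_le {z : ℕ} {ε : ℝ} (hε₀ : 0 ≤ ε) (hε₁ : ε ≤ 1) :
    ((1 + ε / z) * (1 + ε / (16 * z))) ^ z ≤ 1 + 2 * ε := by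
  have hpow : ∀ x : ℝ, 0 ≤ x → (1 + x / z) ^ z ≤ Real.exp x := fun x hx => by
    have hxz : -x ≤ z := by linarith [Nat.cast_nonneg (α := ℝ) z]
    simpa [neg_div] using Real.one_sub_div_pow_le_exp_neg hxz
  calc ((1 + ε / z) * (1 + ε / (16 * z))) ^ z
      = (1 + ε / z) ^ z * (1 + ε / 16 / z) ^ z := by rw [mul_pow, div_div]
    _ ≤ Real.exp ε * Real.exp (ε / 16) := by
        gcongr
        exacts [hpow ε hε₀, hpow _ (by positivity)]
    _ = Real.exp (17 / 16) ^ ε := by rw [← Real.exp_add, ← Real.exp_mul]; ring_nf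
    _ ≤ (1 + 2) ^ ε := by
        gcongr
        linarith [exp_seventeen_sixteenths_le]
    _ ≤ 1 + ε * 2 := rpow_one_add_le_one_add_mul_self (by norm_num) hε₀ hε₁
    _ = 1 + 2 * ε := by rw [mul_comm]

theorem cost_preserved {d m z : ℕ} {ε : ℝ} (hz : 1 ≤ z) (hε₀ : 0 < ε) (hε₁ : ε < 1)
    {S N : Set (E d)} (hS : S.Finite) (hN : IsCenterNet (ε / (16 * z)) S N)
    {Φ : E d →ₗ[ℝ] E m} (hΦ : PreservesDist Φ N (ε / z)) {X : Multiset (EExt d)}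
    (hX : ∀ x ∈ X, x.fst ∈ S) {c : EExt d} {cΦ : EExt m}
    (hc : IsCenterZero z X c) (hcΦ : IsCenterZero z (mapExt Φ X) cΦ) :
    (1 - 2 * ε) * cost z X c ≤ cost z (mapExt Φ X) cΦ ∧
      cost z (mapExt Φ X) cΦ ≤ (1 + 2 * ε) * cost z X c := by
  have hz' : (1 : ℝ) ≤ z := mod_cast hz
  have hδ₁ : ε / z < 1 := (div_lt_one (by positivity)).2 (hε₁.trans_le hz')
  constructor
  · calc (1 - 2 * ε) * cost z X c ≤ (1 - ε / z) ^ z * cost z X c :=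
          mul_le_mul_of_nonneg_right
            (by linarith [one_sub_le_one_sub_div_pow hz hε₁.le]) (cost_nonneg _ _)
      _ ≤ cost z (mapExt Φ X) cΦ :=
          mul_cost_le_cost_mapExt (by positivity) hδ₁ hS
            (fun x hx y hy => hΦ x (hN.subset hx) y (hN.subset hy)) hX hc hcΦ.1
  · calc cost z (mapExt Φ X) cΦ ≤ ((1 + ε / z) * (1 + ε / (16 * z))) ^ z * cost z X c :=
          cost_mapExt_le_mul_cost (by positivity) (by positivity) hN hΦ hX hc.1 hcΦ
      _ ≤ (1 + 2 * ε) * cost z X c :=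
          mul_le_mul_of_nonneg_right (one_add_div_mul_one_add_div_pow_le hε₀.le hε₁.le)
            (cost_nonneg _ _)

/-! ## Approximate centers among few descendants of a point -/

section Descendants

variable {F : Type*} [NormedAddCommGroup F] [NormedSpace ℝ F]

/-- The child number `o` of the node `v`, a point together with a step size, in the direction of
`p`: jump to `p` and let the step size be the length of the jump, halve the step size, or make one
step towards `p`. -/
noncomputable def child (o : Fin 3) (p : F) (v : F × ℝ) : F × ℝ :=
  match o with
  | 0 => (p, dist p v.1)
  | 1 => (v.1, v.2 / 2)
  | 2 => (v.1 + (v.2 / dist p v.1) • (p - v.1), v.2)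

/-- `Descends S v₀ t v`: the node `v` arises from `v₀` by taking `t` times a child in the direction
of some point of `S`. -/
inductive Descends (S : Set F) (v₀ : F × ℝ) : ℕ → F × ℝ → Prop where
  | refl : Descends S v₀ 0 v₀
  | child {t : ℕ} {v : F × ℝ} (o : Fin 3) {p : F} (hp : p ∈ S) :
      Descends S v₀ t v → Descends S v₀ (t + 1) (child o p v)

theorem Descends.jump {S : Set F} {v₀ v : F × ℝ} {t : ℕ} {p : F} (h : Descends S v₀ t v)
    (hp : p ∈ S) : Descends S v₀ (t + 1) (p, dist p v.1) :=
  h.child 0 hp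

theorem Descends.half_iterate {S : Set F} {v₀ : F × ℝ} {t : ℕ} {y : F} {η : ℝ} {p : F}
    (h : Descends S v₀ t (y, η)) (hp : p ∈ S) (j : ℕ) : Descends S v₀ (t + j) (y, η / 2 ^ j) := by
  induction j with
  | zero => simpa using h
  | succ j ih => simpa only [Clustering.child, div_div, ← pow_succ, ← add_assoc] using ih.child 1 hp

theorem Descends.step {S : Set F} {v₀ : F × ℝ} {t : ℕ} {y : F} {η : ℝ} {p : F}
    (h : Descends S v₀ t (y, η)) (hp : p ∈ S) :
    Descends S v₀ (t + 1) (y + (η / dist p y) • (p - y), η) :=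
  h.child 2 hp

end Descendants

section ApproximateCenters

variable {F : Type*} [NormedAddCommGroup F] [InnerProductSpace ℝ F]

theorem dist_sq_step_le {s c p : F} {η : ℝ} (hη : 0 ≤ η) (h : dist p c + η < dist p s) :
    dist (s + (η / dist p s) • (p - s)) c ^ 2 ≤ dist s c ^ 2 - η ^ 2 := by
  have hpc : 0 ≤ dist p c := dist_nonneg
  have hps : 0 < dist p s := by linarith
  have hsc : η ^ 2 ≤ dist s c ^ 2 :=
    pow_le_pow_left₀ hη (by linarith [dist_triangle_right p s c]) 2
  have hpc_sq : dist p c ^ 2 ≤ (dist p s - η) ^ 2 := pow_le_pow_left₀ hpc (by linarith) 2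
  have hstep : dist (s + (η / dist p s) • (p - s)) c ^ 2
      = dist s c ^ 2 + η / dist p s * (2 * inner ℝ (s - c) (p - s)) + η ^ 2 := by
    rw [dist_eq_norm, add_sub_right_comm, norm_add_sq_real, real_inner_smul_right, norm_smul,
      ← dist_eq_norm, ← dist_eq_norm, Real.norm_of_nonneg (by positivity),
      div_mul_cancel₀ _ hps.ne']
    ring
  have hinner : 2 * inner ℝ (s - c) (p - s) = dist p c ^ 2 - dist s c ^ 2 - dist p s ^ 2 := by
    rw [dist_eq_norm p c, ← sub_add_sub_cancel' s c p, norm_add_sq_real, dist_eq_norm, dist_eq_norm]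
    ring
  calc _ = dist s c ^ 2 + η / dist p s * (dist p c ^ 2 - dist s c ^ 2 - dist p s ^ 2) + η ^ 2 := by
        rw [hstep, hinner]
    _ ≤ dist s c ^ 2 + η / dist p s * (-2 * η * dist p s) + η ^ 2 := by
        gcongr
        linarith
    _ = dist s c ^ 2 - η ^ 2 := by field_simp; ring

/-- Each step towards a violated point lowers the squared distance to `c` by `η ^ 2`. -/
theorem Descends.exists_forall_dist_le_add {S : Set F} {v₀ : F × ℝ} {η : ℝ} (hη : 0 ≤ η) {c : F}
    (k : ℕ) {t : ℕ} {s : F} (hs : Descends S v₀ t (s, η))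
    (hk : dist s c ^ 2 < (k + 1) * η ^ 2) :
    ∃ t' ≤ t + k, ∃ s', Descends S v₀ t' (s', η) ∧ ∀ p ∈ S, dist p s' ≤ dist p c + η := by
  induction k generalizing t s with
  | zero =>
    refine ⟨t, le_rfl, s, hs, fun p _ => ?_⟩
    by_contra! hviolated
    have hcloser := dist_sq_step_le hη hviolated
    push_cast at hk
    linarith [sq_nonneg (dist (s + (η / dist p s) • (p - s)) c)]
  | succ k ih =>
    by_cases! hgood : ∀ p ∈ S, dist p s ≤ dist p c + η
    · exact ⟨t, by omega, s, hs, hgood⟩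
    obtain ⟨p, hp, hviolated⟩ := hgood
    have hcloser := dist_sq_step_le hη hviolated
    obtain ⟨t', ht', h⟩ := ih (hs.step hp) (by push_cast at hk; linarith)
    exact ⟨t', by omega, h⟩

theorem exists_div_two_pow_mem_Icc {D r : ℝ} (hr : 0 < r) (hrD : r ≤ D) :
    ∃ j : ℕ, (j : ℝ) ≤ D / r + 1 ∧ D / 2 ^ j ∈ Set.Icc (r / 2) r := by
  obtain ⟨n, hn, hn'⟩ := exists_nat_pow_near ((one_le_div hr).2 hrD) one_lt_two
  have hle : (n : ℝ) ≤ 2 ^ n := mod_cast Nat.lt_two_pow_self.le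
  refine ⟨n + 1, by push_cast; linarith, ?_, ?_⟩
  · rw [le_div_iff₀ hr] at hn
    rw [le_div_iff₀ (by positivity), pow_succ]
    linarith
  · rw [div_lt_iff₀ hr] at hn'
    rw [div_le_iff₀ (by positivity)]
    linarith

/-- If the nearest point `s₀` of `S` is not itself a good substitute for `c`, then `dist s₀ q` is,
up to a factor `2 / δ`, the distance from `c` to `S`. -/
theorem exists_dist_lt_of_isMinOn {F : Type*} [PseudoMetricSpace F] {S : Set F} {c s₀ : F} {δ : ℝ}
    (hδ₀ : 0 < δ) (hδ₁ : δ < 1) (hmin : IsMinOn (dist · c) S s₀)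
    (hbad : ¬ ∀ p ∈ S, dist p s₀ ≤ (1 + δ) * dist p c) :
    ∃ q ∈ S, dist s₀ c < dist s₀ q ∧ dist s₀ q * δ < 2 * dist s₀ c := by
  push Not at hbad
  obtain ⟨q, hq, hfar⟩ := hbad
  have hnear : dist s₀ c ≤ dist q c := hmin hq
  have htri := dist_triangle_right s₀ q c
  rw [dist_comm q s₀] at hfar
  have : δ * dist q c < dist s₀ c := by linarith
  have hnonneg : 0 ≤ δ * dist q c := by positivity
  refine ⟨q, hq, by linarith, ?_⟩
  calc dist s₀ q * δ ≤ (dist s₀ c + dist q c) * δ := by gcongr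
    _ ≤ dist s₀ c * 1 + dist q c * δ := by rw [add_mul]; gcongr
    _ < 2 * dist s₀ c := by linarith

theorem two_add_add_floor_le {δ D R : ℝ} (hδ₀ : 0 < δ) (hδ₁ : δ ≤ 1) (hR : 0 < R)
    (hDR : D * δ ≤ 2 * R) {j K : ℕ} (hj : j ≤ D / (δ * R) + 1) (hK : 9 / δ ^ 2 ≤ K) :
    2 + j + ⌊4 / δ ^ 2⌋₊ ≤ K := by
  have hone : 1 ≤ 1 / δ ^ 2 := (one_le_div (by positivity)).2 (pow_le_one₀ hδ₀.le hδ₁)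
  have hfloor : (⌊4 / δ ^ 2⌋₊ : ℝ) ≤ 4 / δ ^ 2 := Nat.floor_le (by positivity)
  have hratio : D / (δ * R) ≤ 2 / δ ^ 2 := by
    rw [div_le_div_iff₀ (by positivity) (by positivity)]
    nlinarith
  have : ((2 + j + ⌊4 / δ ^ 2⌋₊ : ℕ) : ℝ) ≤ K :=
    calc ((2 + j + ⌊4 / δ ^ 2⌋₊ : ℕ) : ℝ) ≤ 3 * (1 / δ ^ 2) + 2 / δ ^ 2 + 4 / δ ^ 2 := by
          push_cast
          linarith
      _ = 9 / δ ^ 2 := by ring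
      _ ≤ K := hK
  exact_mod_cast this

theorem exists_descends_forall_dist_le {S : Set F} (hS : S.Finite) (v₀ : F × ℝ) {δ : ℝ}
    (hδ₀ : 0 < δ) (hδ₁ : δ < 1) {K : ℕ} (hK : 9 / δ ^ 2 ≤ K) (c : F) :
    ∃ t ≤ K, ∃ v, Descends S v₀ t v ∧ ∀ p ∈ S, dist p v.1 ≤ (1 + δ) * dist p c := by
  obtain rfl | hne := S.eq_empty_or_nonempty
  · exact ⟨0, by omega, v₀, .refl, by simp⟩
  obtain ⟨s₀, hs₀, hmin⟩ := S.exists_min_image (dist · c) hS hne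
  by_cases hgood : ∀ p ∈ S, dist p s₀ ≤ (1 + δ) * dist p c
  · have hK₁ : 1 ≤ K := Nat.cast_pos.1 (hK.trans_lt' (by positivity) : (0 : ℝ) < K)
    exact ⟨1, hK₁, _, Descends.refl.jump hs₀, hgood⟩
  obtain ⟨q, hq, hRD, hDR⟩ := exists_dist_lt_of_isMinOn hδ₀ hδ₁ hmin hgood
  set R := dist s₀ c
  set D := dist s₀ q
  have hR : 0 < R := by nlinarith
  obtain ⟨j, hj, hη₁, hη₂⟩ := exists_div_two_pow_mem_Icc (D := D) (r := δ * R) (by positivity)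
    (by nlinarith)
  set η := D / 2 ^ j
  have hη : 0 < η := hη₁.trans_lt' (by positivity)
  have hstart : Descends S v₀ (1 + 1 + j) (s₀, η) :=
    (((Descends.refl.jump hq).jump hs₀).half_iterate hs₀ j)
  have hsteps : R ^ 2 < (⌊4 / δ ^ 2⌋₊ + 1) * η ^ 2 :=
    calc R ^ 2 = 4 / δ ^ 2 * (δ * R / 2) ^ 2 := by field_simp; ring
      _ ≤ 4 / δ ^ 2 * η ^ 2 := by gcongr
      _ < (⌊4 / δ ^ 2⌋₊ + 1) * η ^ 2 := by
        gcongr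
        exact Nat.lt_floor_add_one _
  obtain ⟨t, ht, s, hs, hdist⟩ := hstart.exists_forall_dist_le_add hη.le _ hsteps
  refine ⟨t, ht.trans (two_add_add_floor_le hδ₀ hδ₁.le hR hDR.le hj hK), _, hs, fun p hp => ?_⟩
  calc dist p s ≤ dist p c + η := hdist p hp
    _ ≤ dist p c + δ * dist p c := by
        gcongr
        exact hη₂.trans (by gcongr; exact hmin p hp)
    _ = (1 + δ) * dist p c := by ring

end ApproximateCenters

/-! ## Breadth-first enumeration of the descendants -/

section SearchTree

variable {F : Type*} [NormedAddCommGroup F] [NormedSpace ℝ F] {n : ℕ} {P : ℕ → F} {v₀ : F × ℝ}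

/-- The descendants of `v₀` in the directions of `P 0, …, P (n - 1)`, numbered such that the
children of node `i` in the direction of `P p` have the numbers `3 * (i * n + p) + o + 1`. -/
noncomputable def searchTree (n : ℕ) (P : ℕ → F) (v₀ : F × ℝ) : ℕ → F × ℝ
  | 0 => v₀
  | k + 1 => child (Fin.ofNat 3 k) (P (k / 3 % n)) (searchTree n P v₀ (k / 3 / n))
decreasing_by exact Nat.lt_succ_of_le ((Nat.div_le_self _ _).trans (Nat.div_le_self _ _))

theorem searchTree_zero : searchTree n P v₀ 0 = v₀ := by
  rw [searchTree]

theorem searchTree_child (i : ℕ) {p : ℕ} (hp : p < n) (o : Fin 3) :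
    searchTree n P v₀ (3 * (i * n + p) + o + 1) = child o (P p) (searchTree n P v₀ i) := by
  have hdiv : (3 * (i * n + p) + o) / 3 = i * n + p := by omega
  have hofNat : Fin.ofNat 3 (3 * (i * n + p) + o) = o := by ext; simp
  rw [searchTree, hdiv, hofNat, mul_comm i n, Nat.mul_add_mod, Nat.mul_add_div (by omega),
    Nat.mod_eq_of_lt hp, Nat.div_eq_of_lt hp, add_zero]

theorem Descends.exists_searchTree_eq {t : ℕ} {v : F × ℝ} (h : Descends (P '' Set.Iio n) v₀ t v) :
    ∃ i < (3 * n + 1) ^ t, searchTree n P v₀ i = v := by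
  induction h with
  | refl => exact ⟨0, by simp, searchTree_zero⟩
  | @child t v o _ hp _ ih =>
    obtain ⟨i, hi, rfl⟩ := ih
    obtain ⟨p, hp, rfl⟩ := hp
    refine ⟨_, ?_, searchTree_child i hp o⟩
    calc 3 * (i * n + p) + o + 1 < (i + 1) * (3 * n + 1) := by
          have : p < n := hp
          nlinarith [o.is_lt]
      _ ≤ (3 * n + 1) ^ (t + 1) := by
          rw [pow_succ]
          exact Nat.mul_le_mul_right _ hi

end SearchTree

theorem isCenterNet_searchTree {F : Type*} [NormedAddCommGroup F] [InnerProductSpace ℝ F] (n : ℕ)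
    (P : ℕ → F) (v₀ : F × ℝ) {δ : ℝ} (hδ₀ : 0 < δ) (hδ₁ : δ < 1) {K : ℕ} (hK : 9 / δ ^ 2 ≤ K) :
    IsCenterNet δ (P '' Set.Iio n)
      ((fun i => (searchTree n P v₀ i).1) '' Set.Iio ((3 * n + 1) ^ K)) := by
  have hmem : ∀ {t v}, t ≤ K → Descends (P '' Set.Iio n) v₀ t v →
      v.1 ∈ (fun i => (searchTree n P v₀ i).1) '' Set.Iio ((3 * n + 1) ^ K) := by
    rintro t _ ht h
    obtain ⟨i, hi, rfl⟩ := h.exists_searchTree_eq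
    exact ⟨i, hi.trans_le (Nat.pow_le_pow_right (by omega) ht), rfl⟩
  have hK₁ : 1 ≤ K := Nat.cast_pos.1 (hK.trans_lt' (by positivity) : (0 : ℝ) < K)
  refine ⟨fun p hp => hmem hK₁ (Descends.refl.jump hp), fun c => ?_⟩
  obtain ⟨t, ht, v, hv, hdist⟩ :=
    exists_descends_forall_dist_le ((Set.finite_Iio n).image P) v₀ hδ₀ hδ₁ hK c
  exact ⟨_, hmem ht hv, hdist⟩

end Clustering

namespace RealRAM

/-! ## Reasoning about programs -/

section Frame

/-- The natural arrays that occur as targets of assignments in a program. -/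
def Prog.natTargets : Prog → Finset ℕ
  | skip => ∅
  | setNat a _ _ => {a}
  | setReal _ _ _ => ∅
  | seq p q => p.natTargets ∪ q.natTargets
  | cond _ p q => p.natTargets ∪ q.natTargets
  | loop _ p => p.natTargets

/-- The real arrays that occur as targets of assignments in a program. -/
def Prog.realTargets : Prog → Finset ℕ
  | skip => ∅
  | setNat _ _ _ => ∅
  | setReal a _ _ => {a}
  | seq p q => p.realTargets ∪ q.realTargets
  | cond _ p q => p.realTargets ∪ q.realTargets
  | loop _ p => p.realTargets

/-- The memories `s` and `s'` agree on all arrays that the program `p` does not write to. -/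
structure Prog.Frame (p : Prog) (s s' : Mem) : Prop where
  nat : ∀ a ∉ p.natTargets, s'.nat a = s.nat a
  real : ∀ a ∉ p.realTargets, s'.real a = s.real a

theorem Prog.Frame.refl (p : Prog) (s : Mem) : p.Frame s s :=
  ⟨fun _ _ => rfl, fun _ _ => rfl⟩

theorem Prog.Frame.trans {p : Prog} {s₁ s₂ s₃ : Mem} (h : p.Frame s₁ s₂) (h' : p.Frame s₂ s₃) :
    p.Frame s₁ s₃ :=
  ⟨fun a ha => (h'.nat a ha).trans (h.nat a ha), fun a ha => (h'.real a ha).trans (h.real a ha)⟩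

theorem Prog.Frame.mono {p q : Prog} {s s' : Mem} (h : p.Frame s s')
    (hnat : p.natTargets ⊆ q.natTargets) (hreal : p.realTargets ⊆ q.realTargets) :
    q.Frame s s' :=
  ⟨fun a ha => h.nat a fun h => ha (hnat h), fun a ha => h.real a fun h => ha (hreal h)⟩

theorem Exec.frame {p : Prog} {s s' : Mem} {t : ℕ} (h : Exec p s t s') : p.Frame s s' := by
  induction h with
  | skip | loopFalse => exact .refl _ _
  | setNat s a i e =>
    exact ⟨fun b hb => Function.update_of_ne (Finset.mem_singleton.not.1 hb) _ _, fun _ _ => rfl⟩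
  | setReal s a i e =>
    exact ⟨fun _ _ => rfl, fun b hb => Function.update_of_ne (Finset.mem_singleton.not.1 hb) _ _⟩
  | seq _ _ ih₁ ih₂ =>
    exact (ih₁.mono Finset.subset_union_left Finset.subset_union_left).trans
      (ih₂.mono Finset.subset_union_right Finset.subset_union_right)
  | condTrue _ _ ih => exact ih.mono Finset.subset_union_left Finset.subset_union_left
  | condFalse _ _ ih => exact ih.mono Finset.subset_union_right Finset.subset_union_right
  | loopTrue _ _ _ ih₁ ih₂ =>
    exact Prog.Frame.trans (ih₁.mono subset_rfl subset_rfl : (Prog.loop _ _).Frame _ _) ih₂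

end Frame

namespace Mem

@[simp] theorem writeNat_real (s : Mem) (a i v : ℕ) : (s.writeNat a i v).real = s.real := rfl

@[simp] theorem writeReal_nat (s : Mem) (a i : ℕ) (v : ℝ) : (s.writeReal a i v).nat = s.nat := rfl

@[simp] theorem writeNat_nat_apply (s : Mem) (a i v a' i' : ℕ) :
    (s.writeNat a i v).nat a' i' = if a' = a ∧ i' = i then v else s.nat a' i' := by
  by_cases ha : a' = a
  · subst ha; simp [writeNat, Function.update_apply]
  · simp [writeNat, ha]

@[simp] theorem writeReal_real_apply (s : Mem) (a i : ℕ) (v : ℝ) (a' i' : ℕ) :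
    (s.writeReal a i v).real a' i' = if a' = a ∧ i' = i then v else s.real a' i' := by
  by_cases ha : a' = a
  · subst ha; simp [writeReal, Function.update_apply]
  · simp [writeReal, ha]

theorem writeReal_real_of_ne (s : Mem) {a a' : ℕ} (h : a' ≠ a) (i : ℕ) (v : ℝ) :
    (s.writeReal a i v).real a' = s.real a' :=
  Function.update_of_ne h _ _

end Mem

@[simp] theorem NExp.eval_writeReal (s : Mem) (a i : ℕ) (v : ℝ) (e : NExp) :
    e.eval (s.writeReal a i v) = e.eval s := by
  induction e <;> simp only [NExp.eval, Mem.writeReal_nat, *]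

section Runs

/-- `Runs p s B Q`: started in the memory `s`, the program `p` halts within `B` steps, in a memory
that satisfies `Q`. -/
def Runs (p : Prog) (s : Mem) (B : ℕ) (Q : Mem → Prop) : Prop :=
  ∃ t s', Exec p s t s' ∧ t ≤ B ∧ Q s'

variable {p q : Prog} {s : Mem} {B B' : ℕ} {Q Q' : Mem → Prop}

theorem Runs.mono (h : Runs p s B Q) (hB : B ≤ B') (hQ : ∀ s', p.Frame s s' → Q s' → Q' s') :
    Runs p s B' Q' := by
  obtain ⟨t, s', hexec, ht, hs'⟩ := h
  exact ⟨t, s', hexec, ht.trans hB, hQ s' hexec.frame hs'⟩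

theorem Runs.seq (h : Runs p s B Q) (h' : ∀ s', p.Frame s s' → Q s' → Runs q s' B' Q') :
    Runs (.seq p q) s (B + B') Q' := by
  obtain ⟨t₁, s₁, hexec₁, ht₁, hs₁⟩ := h
  obtain ⟨t₂, s₂, hexec₂, ht₂, hs₂⟩ := h' s₁ hexec₁.frame hs₁
  exact ⟨_, _, hexec₁.seq hexec₂, add_le_add ht₁ ht₂, hs₂⟩

theorem runs_setNat {a : ℕ} {i e : NExp} (h : Q (s.writeNat a (i.eval s) (e.eval s))) :
    Runs (.setNat a i e) s (i.time + e.time + 1) Q :=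
  ⟨_, _, .setNat s a i e, le_rfl, h⟩

theorem runs_setReal {a : ℕ} {i : NExp} {e : RExp} (h : Q (s.writeReal a (i.eval s) (e.eval s))) :
    Runs (.setReal a i e) s (i.time + e.time + 1) Q :=
  ⟨_, _, .setReal s a i e, le_rfl, h⟩

theorem runs_setNat_seq {a : ℕ} {i e : NExp}
    (h : Runs q (s.writeNat a (i.eval s) (e.eval s)) B Q) :
    Runs (.seq (.setNat a i e) q) s (i.time + e.time + 1 + B) Q :=
  (runs_setNat (Q := (· = s.writeNat a (i.eval s) (e.eval s))) rfl).seq fun _ _ hs => hs ▸ h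

theorem runs_setReal_seq {a : ℕ} {i : NExp} {e : RExp}
    (h : Runs q (s.writeReal a (i.eval s) (e.eval s)) B Q) :
    Runs (.seq (.setReal a i e) q) s (i.time + e.time + 1 + B) Q :=
  (runs_setReal (Q := (· = s.writeReal a (i.eval s) (e.eval s))) rfl).seq fun _ _ hs => hs ▸ h

theorem runs_loop {b : Test} (N : ℕ) (Inv : ℕ → Mem → Prop)
    (htest : ∀ k ≤ N, ∀ s, Inv k s → (b.holds s ↔ k < N))
    (hstep : ∀ k < N, ∀ s, Inv k s → Runs p s B (Inv (k + 1))) (h₀ : Inv 0 s) :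
    Runs (.loop b p) s (N * (b.time + B) + b.time) (Inv N) := by
  suffices h : ∀ m ≤ N, ∀ s, Inv (N - m) s →
      Runs (.loop b p) s (m * (b.time + B) + b.time) (Inv N) from
    h N le_rfl s (by rwa [Nat.sub_self])
  intro m hm
  induction m with
  | zero =>
    intro s hs
    exact ⟨_, s, .loopFalse (by simp [htest N le_rfl s hs]), by simp, hs⟩
  | succ m ih =>
    intro s hs
    obtain ⟨t₁, s₁, hexec₁, ht₁, hs₁⟩ := hstep _ (by omega) s hs
    rw [show N - (m + 1) + 1 = N - m by omega] at hs₁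
    obtain ⟨t₂, s₂, hexec₂, ht₂, hs₂⟩ := ih (by omega) s₁ hs₁
    refine ⟨_, s₂, .loopTrue ((htest _ (by omega) s hs).2 (by omega)) hexec₁ hexec₂, ?_, hs₂⟩
    rw [Nat.succ_mul]
    omega

/-- The natural variable that is kept in cell `0` of array `a`. -/
abbrev NExp.var (a : ℕ) : NExp := .load a (.const 0)

/-- `for v < e do p`, where `v` is a natural variable. -/
def forLoop (v : ℕ) (e : NExp) (p : Prog) : Prog :=
  .seq (.setNat v (.const 0) (.const 0))
    (.loop (.natLt (.var v) e) (.seq p (.setNat v (.const 0) (.add (.var v) (.const 1)))))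

theorem runs_forLoop {v : ℕ} {e : NExp} (N : ℕ) (Inv : ℕ → (ℕ → ℕ → ℝ) → Prop)
    (hv : v ∉ p.natTargets) (he : ∀ s', (forLoop v e p).Frame s s' → e.eval s' = N)
    (hstep : ∀ k < N, ∀ s', (forLoop v e p).Frame s s' → s'.nat v 0 = k → Inv k s'.real →
      Runs p s' B fun s'' => Inv (k + 1) s''.real)
    (h₀ : Inv 0 s.real) :
    Runs (forLoop v e p) s (N * (B + e.time + 9) + e.time + 6) fun s' => Inv N s'.real := by
  have hnat : p.natTargets ⊆ (forLoop v e p).natTargets := fun a ha => by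
    simp [forLoop, Prog.natTargets, ha]
  have hreal : p.realTargets ⊆ (forLoop v e p).realTargets := fun a ha => by
    simp [forLoop, Prog.realTargets, ha]
  have hcounter : ∀ s₁ k, (forLoop v e p).Frame s₁ (s₁.writeNat v 0 k) := fun s₁ k =>
    ⟨fun a ha => Function.update_of_ne (fun h => ha (by simp [forLoop, Prog.natTargets, h])) _ _,
      fun _ _ => rfl⟩
  have hbody : ∀ k < N, ∀ s', (forLoop v e p).Frame s s' ∧ s'.nat v 0 = k ∧ Inv k s'.real →
      Runs (.seq p (.setNat v (.const 0) (.add (.var v) (.const 1)))) s' (B + 6) fun s'' =>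
        (forLoop v e p).Frame s s'' ∧ s''.nat v 0 = k + 1 ∧ Inv (k + 1) s''.real := by
    rintro k hk s' ⟨hframe, hk', hinv⟩
    refine (hstep k hk s' hframe hk' hinv).seq fun s'' hframe' hinv' => runs_setNat ?_
    refine ⟨(hframe.trans (hframe'.mono hnat hreal)).trans (hcounter _ _), ?_, hinv'⟩
    simp [NExp.eval, hframe'.nat v hv, hk']
  have hloop := runs_loop (b := .natLt (.var v) e) N
    (fun k s' => (forLoop v e p).Frame s s' ∧ s'.nat v 0 = k ∧ Inv k s'.real)
    (fun k _ s' hs' => by simp only [Test.holds, NExp.eval, he s' hs'.1, hs'.2.1]) hbody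
    ⟨hcounter s 0, by simp, h₀⟩
  refine (runs_setNat_seq hloop).mono ?_ fun s' _ hs' => hs'.2.2
  simp only [NExp.time, Test.time]
  rw [show 1 + 1 + e.time + 1 + (B + 6) = B + e.time + 9 by ring]
  omega

end Runs

end RealRAM

namespace Clustering

open RealRAM

/-! ## The program -/

/-- The cell of a coordinate of the point number `e` in an array of points; the index of the
coordinate is kept in the natural variable `5`. -/
def coord (e : NExp) : NExp := .add (.mul e (.var 0)) (.var 5)

/-- The number of a child in the search tree. The parent is kept in the natural variable `3`, the
input point towards which it moves in the natural variable `4`. -/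
def childNode (o : ℕ) : NExp :=
  .add (.mul (.const 3) (.add (.mul (.var 3) (.load 0 (.const 1))) (.var 4))) (.const (o + 1))

/-- Add the square of one coordinate of the difference between the current node and the current
input point to the real variable `4`. -/
def addSqProg : Prog :=
  .setReal 4 (.const 0) (.add (.load 4 (.const 0))
    (.mul (.sub (.load 1 (coord (.var 4))) (.load 2 (coord (.var 3))))
      (.sub (.load 1 (coord (.var 4))) (.load 2 (coord (.var 3))))))

/-- Store the distance between the current node and the current input point in the real
variable `4`. -/
def distProg : Prog :=
  .seq (.setReal 4 (.const 0) (.ofNat (.const 0))) <|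
  .seq (forLoop 5 (.var 0) addSqProg) <|
  .setReal 4 (.const 0) (.sqrt (.load 4 (.const 0)))

/-- Store the step sizes of the three children in the real array `3`. -/
def sizesProg : Prog :=
  .seq (.setReal 3 (childNode 0) (.load 4 (.const 0))) <|
  .seq (.setReal 3 (childNode 1) (.div (.load 3 (.var 3)) (.ofNat (.const 2)))) <|
  .setReal 3 (childNode 2) (.load 3 (.var 3))

/-- Store one coordinate of the positions of the three children in the real array `2`. -/
def coordProg : Prog :=
  .seq (.setReal 2 (coord (childNode 0)) (.load 1 (coord (.var 4)))) <|
  .seq (.setReal 2 (coord (childNode 1)) (.load 2 (coord (.var 3)))) <|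
  .setReal 2 (coord (childNode 2)) (.add (.load 2 (coord (.var 3)))
    (.mul (.div (.load 3 (.var 3)) (.load 4 (.const 0)))
      (.sub (.load 1 (coord (.var 4))) (.load 2 (coord (.var 3))))))

/-- Store the three children of the current node for the current input point. -/
def childrenProg : Prog :=
  .seq distProg <| .seq sizesProg <| forLoop 5 (.var 0) coordProg

/-- Store the children of the nodes whose numbers are less than the natural variable `1`. -/
def expandProg : Prog :=
  forLoop 3 (.var 1) (forLoop 4 (.load 0 (.const 1)) childrenProg)

/-- The depth to which the search tree is expanded. It is at least `9 / δ ^ 2` for the accuracy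
`δ = ε / (16 * z)`. -/
noncomputable def depth (z : ℕ) (ε : ℝ) : ℕ := ⌈2304 * z ^ 2 / ε ^ 2⌉₊

/-- Store `(3 * n + 1) ^ depth z ε` in the natural variable `1`, where `n` is the number of input
points; the natural variable `2` counts up to `depth z ε`. -/
def depthProg : Prog :=
  .seq (.setNat 1 (.const 0) (.const 1)) <|
  .loop (.realLt (.mul (.ofNat (.var 2)) (.mul (.load 0 (.const 0)) (.load 0 (.const 0))))
      (.mul (.ofNat (.const 2304))
        (.mul (.ofNat (.load 0 (.const 2))) (.ofNat (.load 0 (.const 2))))))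
    (.seq (.setNat 2 (.const 0) (.add (.var 2) (.const 1))) <|
      .setNat 1 (.const 0)
        (.mul (.var 1) (.add (.mul (.const 3) (.load 0 (.const 1))) (.const 1))))

/-- The program that computes the net. It enumerates the search tree whose root is the origin with
step size `0`. -/
def netProg : Prog := .seq depthProg expandProg

/-! ## Correctness of the program -/

section Rows

variable {d : ℕ}

/-- The `i`-th point of an array that stores points by their consecutive coordinates. -/
noncomputable def row (d : ℕ) (a : ℕ → ℝ) (i : ℕ) : E d := WithLp.toLp 2 fun j => a (i * d + j)

/-- The `i`-th node of the search tree, whose position is stored in the real array `2` and whose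
step size is stored in the real array `3`. -/
noncomputable def nodeAt (d : ℕ) (ρ : ℕ → ℕ → ℝ) (i : ℕ) : E d × ℝ := (row d (ρ 2) i, ρ 3 i)

theorem mul_add_eq_mul_add_iff {a b j k : ℕ} (hj : j < d) (hk : k < d) :
    a * d + j = b * d + k ↔ a = b ∧ j = k := by
  refine ⟨fun h => ?_, by rintro ⟨rfl, rfl⟩; rfl⟩
  have hd : 0 < d := by omega
  have hdiv := congrArg (· / d) h
  have hmod := congrArg (· % d) h
  simp only [mul_comm _ d, Nat.mul_add_div hd, Nat.mul_add_mod, Nat.div_eq_of_lt hj,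
    Nat.div_eq_of_lt hk, Nat.mod_eq_of_lt hj, Nat.mod_eq_of_lt hk] at hdiv hmod
  omega

theorem row_apply (a : ℕ → ℝ) (i : ℕ) (j : Fin d) : row d a i j = a (i * d + j) := rfl

theorem row_writeReal_apply (s : Mem) (a b k : ℕ) (hk : k < d) (v : ℝ) (i : ℕ) (j : Fin d) :
    row d ((s.writeReal a (b * d + k) v).real a) i j
      = if i = b ∧ (j : ℕ) = k then v else row d (s.real a) i j := by
  simp only [row_apply, Mem.writeReal_real_apply, true_and, mul_add_eq_mul_add_iff j.2 hk]

theorem dist_row (a b : ℕ → ℝ) (p i : ℕ) :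
    dist (row d a p) (row d b i)
      = √(∑ j ∈ Finset.range d, (a (p * d + j) - b (i * d + j)) ^ 2) := by
  simp only [EuclideanSpace.dist_eq, row_apply, Real.dist_eq, sq_abs,
    Finset.sum_range fun j => (a (p * d + j) - b (i * d + j)) ^ 2]

end Rows

section Children

variable {d n i p : ℕ} {s s' : Mem}

/-- The natural variables of `s` specify the node `i` and the point `p` of an input of `n` points
in dimension `d`. -/
structure AtEdge (d n i p : ℕ) (s : Mem) : Prop where
  dim : s.nat 0 0 = d
  card : s.nat 0 1 = n
  node : s.nat 3 0 = i
  point : s.nat 4 0 = p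
  lt : p < n

theorem AtEdge.of_frame (h : AtEdge d n i p s) {q : Prog} (hframe : q.Frame s s')
    (hq : q.natTargets ⊆ {5}) : AtEdge d n i p s' := by
  have hnat : ∀ a ≠ 5, s'.nat a = s.nat a := fun a ha =>
    hframe.nat a fun h => ha (Finset.mem_singleton.1 (hq h))
  exact ⟨by rw [hnat 0 (by decide), h.dim], by rw [hnat 0 (by decide), h.card],
    by rw [hnat 3 (by decide), h.node], by rw [hnat 4 (by decide), h.point], h.lt⟩

theorem AtEdge.node_le (h : AtEdge d n i p s) : i ≤ i * n + p := by
  have := Nat.le_mul_of_pos_right i (Nat.zero_lt_of_lt h.lt)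
  omega

theorem AtEdge.eval_coord (h : AtEdge d n i p s) (e : NExp) :
    (coord e).eval s = e.eval s * d + s.nat 5 0 := by
  simp only [coord, NExp.eval, h.dim]

theorem AtEdge.eval_childNode (h : AtEdge d n i p s) (o : ℕ) :
    (childNode o).eval s = 3 * (i * n + p) + o + 1 := by
  simp only [childNode, NExp.eval, h.card, h.node, h.point, add_assoc]

theorem AtEdge.runs_addSqProg (h : AtEdge d n i p s) {k : ℕ} (hk : s.nat 5 0 = k) :
    Runs addSqProg s 64 fun s' =>
      s'.real 4 0 = s.real 4 0 + (s.real 1 (p * d + k) - s.real 2 (i * d + k)) ^ 2 := by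
  refine (runs_setReal ?_).mono (by simp [coord, NExp.time, RExp.time]) fun _ _ => id
  simp only [Mem.writeReal_real_apply, NExp.eval, RExp.eval, h.eval_coord, h.point, h.node, hk]
  simp [sq]

theorem AtEdge.runs_distProg (h : AtEdge d n i p s) :
    Runs distProg s (d * 80 + 20) fun s' =>
      s'.real 4 0 = dist (row d (s.real 1) p) (row d (s.real 2) i) := by
  have hloop : ∀ s₁ : Mem, AtEdge d n i p s₁ → s₁.real 4 0 = 0 →
      Runs (forLoop 5 (.var 0) addSqProg) s₁ (d * 75 + 8) fun s' => s'.real 4 0 =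
        ∑ j ∈ Finset.range d, (s₁.real 1 (p * d + j) - s₁.real 2 (i * d + j)) ^ 2 := by
    intro s₁ h₁ h₀
    refine (runs_forLoop (B := 64) d (fun k ρ => ρ 4 0 =
      ∑ j ∈ Finset.range k, (s₁.real 1 (p * d + j) - s₁.real 2 (i * d + j)) ^ 2)
      (by decide) (fun s' hframe => ?_) (fun k _ s' hframe hk hsum => ?_) (by simpa)).mono
        (by simp only [NExp.time]; omega) fun _ _ => id
    · exact (h₁.of_frame hframe (by decide)).dim
    · refine ((h₁.of_frame hframe (by decide)).runs_addSqProg hk).mono le_rfl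
        fun s'' _ hs'' => ?_
      rw [hs'', hsum, Finset.sum_range_succ, hframe.real 1 (by decide), hframe.real 2 (by decide)]
  refine (runs_setReal_seq ((hloop (s.writeReal _ _ _)
    ⟨h.dim, h.card, h.node, h.point, h.lt⟩ ?_).seq
      fun s' _ hsum => runs_setReal ?_)).mono ?_ fun _ _ => id
  · simp [RExp.eval, NExp.eval]
  · simp [RExp.eval, NExp.eval, hsum, dist_row]
  · simp only [NExp.time, RExp.time]
    omega

theorem AtEdge.runs_sizesProg (h : AtEdge d n i p s) {q : E d}
    (hdist : s.real 4 0 = dist q (row d (s.real 2) i)) :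
    Runs sizesProg s 60 fun s' =>
      (∀ r ≤ 3 * (i * n + p), s'.real 3 r = s.real 3 r) ∧
      ∀ o : Fin 3, s'.real 3 (3 * (i * n + p) + o + 1) = (child o q (nodeAt d s.real i)).2 := by
  refine (runs_setReal_seq (runs_setReal_seq (runs_setReal ?_))).mono
    (by simp [childNode, NExp.time, RExp.time]) fun _ _ => id
  have hle := h.node_le
  have hne : ∀ r ≤ 3 * (i * n + p), ∀ o : ℕ, r ≠ 3 * (i * n + p) + o + 1 := by omega
  simp only [RExp.eval, NExp.eval, NExp.eval_writeReal, Mem.writeReal_nat, h.eval_childNode, h.node,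
    Mem.writeReal_real_apply, hne i (by omega), hne i (by omega) 0, and_false, if_false]
  refine ⟨fun r hr => ?_, fun o => ?_⟩
  · simp only [hne r hr, hne r hr 0, and_false, if_false]
  · fin_cases o <;> simp [child, nodeAt, hdist]

theorem AtEdge.runs_coordProg (h : AtEdge d n i p s) {k : Fin d} (hk : s.nat 5 0 = k) {q : E d}
    (hq : row d (s.real 1) p = q) (hdist : s.real 4 0 = dist q (row d (s.real 2) i)) :
    Runs coordProg s 130 fun s' =>
      (∀ r ≤ 3 * (i * n + p), row d (s'.real 2) r = row d (s.real 2) r) ∧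
      ∀ o : Fin 3, ∀ j, row d (s'.real 2) (3 * (i * n + p) + o + 1) j =
        if j = k then (child o q (nodeAt d s.real i)).1 j
        else row d (s.real 2) (3 * (i * n + p) + o + 1) j := by
  refine (runs_setReal_seq (runs_setReal_seq (runs_setReal ?_))).mono
    (by simp [coord, childNode, NExp.time, RExp.time]) fun _ _ => id
  have hle := h.node_le
  have hne : ∀ r ≤ 3 * (i * n + p), ∀ o : ℕ, r ≠ 3 * (i * n + p) + o + 1 := by omega
  simp only [RExp.eval, NExp.eval, NExp.eval_writeReal, Mem.writeReal_nat, h.eval_coord,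
    h.eval_childNode, h.node, h.point, hk, ← row_apply]
  refine ⟨fun r hr => ?_, fun o j => ?_⟩
  · ext j
    simp only [row_writeReal_apply _ _ _ _ k.2, hne r hr, hne r hr 0, false_and, if_false]
  · fin_cases o <;> by_cases hjk : j = k <;>
      simp [row_writeReal_apply _ _ _ _ k.2, hne i (by omega), hne i (by omega) 0, child, nodeAt,
        Mem.writeReal_real_of_ne, hq, hdist, hjk, Fin.val_inj]

theorem AtEdge.runs_coordLoop (h : AtEdge d n i p s) {q : E d} (hq : row d (s.real 1) p = q)
    (hdist : s.real 4 0 = dist q (row d (s.real 2) i)) :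
    Runs (forLoop 5 (.var 0) coordProg) s (d * 141 + 8) fun s' =>
      (∀ r ≤ 3 * (i * n + p), row d (s'.real 2) r = row d (s.real 2) r) ∧
      ∀ o : Fin 3, row d (s'.real 2) (3 * (i * n + p) + o + 1) =
        (child o q (nodeAt d s.real i)).1 := by
  refine (runs_forLoop (B := 130) d (fun k ρ =>
    (∀ r ≤ 3 * (i * n + p), row d (ρ 2) r = row d (s.real 2) r) ∧
      ∀ o : Fin 3, ∀ j : Fin d, j < k → row d (ρ 2) (3 * (i * n + p) + o + 1) j =
        (child o q (nodeAt d s.real i)).1 j)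
    (by decide) (fun s' hframe => ?_) ?_
    ⟨fun _ _ => rfl, fun _ _ hj => absurd hj (Nat.not_lt_zero _)⟩).mono
      (by simp only [NExp.time]; omega) fun s' _ hs' => ⟨hs'.1, fun o => ?_⟩
  · exact (h.of_frame hframe (by decide)).dim
  · rintro k hk s' hframe hk' ⟨hold, hnew⟩
    have hi : row d (s'.real 2) i = row d (s.real 2) i := hold i (by have := h.node_le; omega)
    have hnode : nodeAt d s'.real i = nodeAt d s.real i := by
      rw [nodeAt, hi, hframe.real 3 (by decide), nodeAt]
    refine ((h.of_frame hframe (by decide)).runs_coordProg (k := ⟨k, hk⟩) hk'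
      (by rw [hframe.real 1 (by decide), hq])
      (by rw [hframe.real 4 (by decide), hi, hdist])).mono le_rfl fun s'' _ hs'' => ?_
    refine ⟨fun r hr => (hs''.1 r hr).trans (hold r hr), fun o j hj => ?_⟩
    rw [hs''.2, hnode]
    split_ifs with hjk
    · rfl
    · exact hnew o j (by have := Fin.val_ne_of_ne hjk; simp only at this; omega)
  · ext j
    exact hs'.2 o j j.2

theorem AtEdge.runs_childrenProg (h : AtEdge d n i p s) :
    Runs childrenProg s (d * 240 + 100) fun s' =>
      (∀ r ≤ 3 * (i * n + p), nodeAt d s'.real r = nodeAt d s.real r) ∧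
      ∀ o : Fin 3, nodeAt d s'.real (3 * (i * n + p) + o + 1) =
        child o (row d (s.real 1) p) (nodeAt d s.real i) := by
  refine Runs.mono (B := d * 80 + 20 + (60 + (d * 141 + 8))) (h.runs_distProg.seq
    fun s₁ hframe₁ hdist => ?_) (by omega) fun _ _ => id
  have hdist₁ : s₁.real 4 0 = dist (row d (s.real 1) p) (row d (s₁.real 2) i) := by
    rw [hdist, hframe₁.real 2 (by decide)]
  have h₁ := h.of_frame hframe₁ (by decide)
  refine (h₁.runs_sizesProg hdist₁).seq fun s₂ hframe₂ hsizes => ?_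
  have hpoint : row d (s₂.real 1) p = row d (s.real 1) p := by
    rw [hframe₂.real 1 (by decide), hframe₁.real 1 (by decide)]
  have hpos : s₂.real 2 = s.real 2 := by
    rw [hframe₂.real 2 (by decide), hframe₁.real 2 (by decide)]
  have hsize : s₁.real 3 = s.real 3 := hframe₁.real 3 (by decide)
  have hdist₂ : s₂.real 4 0 = dist (row d (s.real 1) p) (row d (s₂.real 2) i) := by
    rw [hframe₂.real 4 (by decide), hdist, hpos]
  have hnode₁ : nodeAt d s₁.real i = nodeAt d s.real i := by
    rw [nodeAt, hframe₁.real 2 (by decide), hsize, nodeAt]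
  have hnode₂ : nodeAt d s₂.real i = nodeAt d s.real i := by
    rw [nodeAt, hpos, hsizes.1 i (by have := h.node_le; omega), hsize, nodeAt]
  refine ((h₁.of_frame hframe₂ (by decide)).runs_coordLoop hpoint hdist₂).mono le_rfl
    fun s₃ hframe₃ hcoords => ⟨fun r hr => Prod.ext ?_ ?_, fun o => Prod.ext ?_ ?_⟩
  · rw [nodeAt, hcoords.1 r hr, hpos, nodeAt]
  · rw [nodeAt, hframe₃.real 3 (by decide), hsizes.1 r hr, hsize, nodeAt]
  · rw [nodeAt, hcoords.2 o, hnode₂]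
  · rw [nodeAt, hframe₃.real 3 (by decide), hsizes.2 o, hnode₁]

end Children

section Expand

variable {d n i : ℕ} {s : Mem} {P : ℕ → E d} {v₀ : E d × ℝ}

/-- The first `3 * k + 1` nodes of the search tree, that is the root and the children for the first
`k` pairs of a node and a point, are stored in the real memory. -/
def StoresTree (n : ℕ) (P : ℕ → E d) (v₀ : E d × ℝ) (k : ℕ) (ρ : ℕ → ℕ → ℝ) : Prop :=
  ∀ r ≤ 3 * k, nodeAt d ρ r = searchTree n P v₀ r

theorem AtEdge.runs_childrenProg_storesTree {p : ℕ} (h : AtEdge d n i p s)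
    (hP : row d (s.real 1) = P) (htree : StoresTree n P v₀ (i * n + p) s.real) :
    Runs childrenProg s (d * 240 + 100) fun s' => StoresTree n P v₀ (i * n + p + 1) s'.real := by
  refine h.runs_childrenProg.mono le_rfl fun s' _ ⟨hold, hnew⟩ r hr => ?_
  rcases le_or_gt r (3 * (i * n + p)) with hle | hlt
  · rw [hold r hle, htree r hle]
  · obtain ⟨o, rfl⟩ : ∃ o : Fin 3, r = 3 * (i * n + p) + o + 1 :=
      ⟨⟨r - (3 * (i * n + p) + 1), by omega⟩, by simp only; omega⟩
    rw [hnew o, htree i (by have := h.node_le; omega), searchTree_child i h.lt, hP]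

theorem runs_expandProg {M : ℕ} (hd : s.nat 0 0 = d) (hn : s.nat 0 1 = n) (hM : s.nat 1 0 = M) :
    Runs expandProg s (M * (n * (d * 240 + 111) + 19) + 8) fun s' =>
      StoresTree n (row d (s.real 1)) (nodeAt d s.real 0) (M * n) s'.real := by
  have hroot : StoresTree n (row d (s.real 1)) (nodeAt d s.real 0) 0 s.real := fun r hr => by
    rw [Nat.le_zero.1 hr, searchTree_zero]
  refine (runs_forLoop (B := n * (d * 240 + 111) + 8) M
    (fun k => StoresTree n (row d (s.real 1)) (nodeAt d s.real 0) (k * n)) (by decide)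
    (fun s' hframe => ?_) (fun i _ s₁ hframe₁ hi htree => ?_) (by rwa [Nat.zero_mul])).mono
      (by simp only [NExp.time]; ring_nf; rfl) fun _ _ => id
  · exact (congrFun (hframe.nat 1 (by decide)) 0).trans hM
  refine (runs_forLoop (B := d * 240 + 100) n
    (fun k => StoresTree n (row d (s.real 1)) (nodeAt d s.real 0) (i * n + k)) (by decide)
    (fun s' hframe => ?_) (fun p hp s₂ hframe₂ hp' htree => ?_) htree).mono
      (by simp only [NExp.time]; ring_nf; rfl) fun s' _ hs' => by rwa [Nat.succ_mul]
  · rw [NExp.eval, hframe.nat 0 (by decide), hframe₁.nat 0 (by decide)]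
    exact hn
  · have hnat : s₂.nat 0 = s.nat 0 := by rw [hframe₂.nat 0 (by decide), hframe₁.nat 0 (by decide)]
    have hedge : AtEdge d n i p s₂ :=
      ⟨by rw [hnat, hd], by rw [hnat, hn], by rw [hframe₂.nat 3 (by decide), hi], hp', hp⟩
    exact hedge.runs_childrenProg_storesTree
      (by rw [hframe₂.real 1 (by decide), hframe₁.real 1 (by decide)]) htree

end Expand

section Net

variable {d n z : ℕ} {ε : ℝ} {s : Mem}

theorem lt_depth_iff (hε : 0 < ε) {k : ℕ} :
    k < depth z ε ↔ (k : ℝ) * (ε * ε) < (2304 : ℕ) * ((z : ℝ) * z) := by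
  rw [depth, Nat.lt_ceil, lt_div_iff₀ (by positivity), pow_two, pow_two, Nat.cast_ofNat]

theorem runs_depthProg (hε : 0 < ε) (hn : s.nat 0 1 = n) (hz : s.nat 0 2 = z)
    (hcounter : s.nat 2 0 = 0) (hreal : s.real 0 0 = ε) :
    Runs depthProg s (depth z ε * 50 + 30) fun s' => s'.nat 1 0 = (3 * n + 1) ^ depth z ε := by
  refine (runs_setNat_seq ((runs_loop (B := 20) (depth z ε) (fun k s' => (s'.nat 0 1 = n ∧
    s'.nat 0 2 = z ∧ s'.real 0 0 = ε) ∧ s'.nat 2 0 = k ∧ s'.nat 1 0 = (3 * n + 1) ^ k)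
      ?_ ?_ ?_).mono le_rfl fun s' _ hs' => hs'.2.2)).mono ?_ fun _ _ => id
  · rintro k - s' ⟨⟨-, hz', hε'⟩, hk, -⟩
    simp only [Test.holds, RExp.eval, NExp.eval, hz', hε', hk, lt_depth_iff hε]
  · rintro k - s' ⟨⟨hn', hz', hε'⟩, hk, hpow⟩
    refine (runs_setNat_seq (runs_setNat ?_)).mono (by simp [NExp.time]) fun _ _ => id
    simp [NExp.eval, hn', hz', hε', hk, hpow, pow_succ]
  · simp [NExp.eval, hn, hz, hcounter, hreal]
  · simp only [NExp.time, RExp.time, Test.time]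
    omega

theorem runs_netProg (hε : 0 < ε) (hd : s.nat 0 0 = d) (hn : s.nat 0 1 = n) (hz : s.nat 0 2 = z)
    (hcounter : s.nat 2 0 = 0) (hreal : s.real 0 0 = ε) :
    Runs netProg s (depth z ε * 50 + 30 +
        ((3 * n + 1) ^ depth z ε * (n * (d * 240 + 111) + 19) + 8)) fun s' =>
      s'.nat 1 0 = (3 * n + 1) ^ depth z ε ∧
      ∀ r < (3 * n + 1) ^ depth z ε, row d (s'.real 2) r =
        (searchTree n (row d (s.real 1)) (nodeAt d s.real 0) r).1 := by
  refine (runs_depthProg hε hn hz hcounter hreal).seq fun s₁ hframe₁ hcount => ?_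
  have hnat : s₁.nat 0 = s.nat 0 := hframe₁.nat 0 (by decide)
  have hreal₁ : s₁.real = s.real := funext fun a => hframe₁.real a (Finset.notMem_empty a)
  refine (runs_expandProg (by rw [hnat, hd]) (by rw [hnat, hn]) hcount).mono le_rfl
    fun s₂ hframe₂ htree => ⟨(congrFun (hframe₂.nat 1 (by decide)) 0).trans hcount, fun r hr => ?_⟩
  rw [← hreal₁, ← htree r ?_, nodeAt]
  rcases Nat.eq_zero_or_pos n with rfl | hpos
  · rw [mul_zero, zero_add, one_pow] at hr
    omega
  · have := Nat.le_mul_of_pos_right ((3 * n + 1) ^ depth z ε) hpos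
    omega

end Net

/-! ## The output of the program -/

section Output

variable {d z : ℕ} {ε : ℝ}

theorem outputSet_eq_image_row (d : ℕ) (s : Mem) :
    outputSet d s = row d (s.real 2) '' Set.Iio (s.nat 1 0) := by
  ext x
  refine exists_congr fun i => and_congr_right fun _ => ⟨fun h => ?_, ?_⟩
  · ext j
    exact (h j).symm
  · rintro rfl j
    rfl

theorem finite_outputSet (d : ℕ) (s : Mem) : (outputSet d s).Finite := by
  rw [outputSet_eq_image_row]
  exact (Set.finite_Iio _).image _

theorem ncard_outputSet_le (d : ℕ) (s : Mem) : (outputSet d s).ncard ≤ s.nat 1 0 := by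
  rw [outputSet_eq_image_row]
  simpa using Set.ncard_image_le (f := row d (s.real 2)) (Set.finite_Iio (s.nat 1 0))

theorem row_inputMem (L : List (E d)) (i : Fin L.length) :
    row d ((inputMem z ε L).real 1) i = L.get i := by
  ext j
  have hd : 0 < d := j.pos
  have hdiv : (i * d + j : ℕ) / d = i := by
    rw [mul_comm, Nat.mul_add_div hd, Nat.div_eq_of_lt j.2, add_zero]
  have hmod : (i * d + j : ℕ) % d = j := by
    rw [mul_comm, Nat.mul_add_mod, Nat.mod_eq_of_lt j.2]
  simp [row_apply, inputMem, hdiv, hmod, hd]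

theorem image_row_inputMem (L : List (E d)) :
    row d ((inputMem z ε L).real 1) '' Set.Iio L.length = {p | p ∈ L} := by
  ext p
  refine ⟨?_, fun hp => ?_⟩
  · rintro ⟨i, hi, rfl⟩
    rw [Set.mem_ofPred_eq, row_inputMem L ⟨i, hi⟩]
    exact L.get_mem _
  · obtain ⟨i, rfl⟩ := List.mem_iff_get.1 hp
    exact ⟨i, i.2, row_inputMem L i⟩

theorem runs_netProg_inputMem (hz : 1 ≤ z) (hε₀ : 0 < ε) (hε₁ : ε < 1) (L : List (E d)) :
    Runs netProg (inputMem z ε L) (depth z ε * 50 + 30 +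
        ((3 * L.length + 1) ^ depth z ε * (L.length * (d * 240 + 111) + 19) + 8)) fun s =>
      s.nat 1 0 = (3 * L.length + 1) ^ depth z ε ∧
      IsCenterNet (ε / (16 * z)) {p | p ∈ L} (outputSet d s) := by
  have hz' : (1 : ℝ) ≤ z := by exact_mod_cast hz
  refine (runs_netProg (d := d) (n := L.length) (z := z) hε₀ rfl rfl rfl rfl rfl).mono le_rfl
    fun s _ ⟨hcount, hrow⟩ => ⟨hcount, ?_⟩
  rw [outputSet_eq_image_row, hcount, Set.image_congr (s := Set.Iio _) hrow,
    ← image_row_inputMem (z := z) (ε := ε) L]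
  refine isCenterNet_searchTree _ _ _ (by positivity) ?_ ?_
  · rw [div_lt_one (by positivity)]
    linarith
  · have hconst : (9 : ℝ) / (ε / (16 * z)) ^ 2 = 2304 * z ^ 2 / ε ^ 2 := by
      field_simp
      norm_num
    exact hconst.trans_le (Nat.le_ceil _)

end Output

section Bounds

variable {T n d K z : ℕ} {ε : ℝ}

theorem pow_le_pow_four_mul (hT : 2 ≤ T) (hn : n ≤ T) : (3 * n + 1) ^ K ≤ T ^ (4 * K) := by
  rw [pow_mul]
  refine Nat.pow_le_pow_left ?_ K
  calc 3 * n + 1 ≤ 2 ^ 3 * T := by omega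
    _ ≤ T ^ 3 * T := Nat.mul_le_mul_right _ (Nat.pow_le_pow_left hT 3)
    _ = T ^ 4 := by ring

theorem time_le_mul_pow (hT : 2 ≤ T) (hn : n ≤ T) :
    K * 50 + 30 + ((3 * n + 1) ^ K * (n * (d * 240 + 111) + 19) + 8)
      ≤ (d + 1) * T ^ (4 * K + 10) := by
  have hM := pow_le_pow_four_mul (K := K) hT hn
  have hK : K ≤ T ^ (4 * K) := Nat.lt_two_pow_self.le.trans
    ((Nat.pow_le_pow_left hT K).trans (Nat.pow_le_pow_right (by omega) (by omega)))
  have hone : 1 ≤ T ^ (4 * K) := Nat.one_le_pow _ _ (by omega)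
  set W := T ^ (4 * K)
  have hnode : n * (d * 240 + 111) + 19 ≤ (d + 1) * (250 * T) := by
    have := Nat.mul_le_mul_right (d * 240 + 111) hn
    nlinarith
  have hlinear : 1 ≤ (d + 1) * T := Nat.mul_pos d.succ_pos (by omega)
  calc K * 50 + 30 + ((3 * n + 1) ^ K * (n * (d * 240 + 111) + 19) + 8)
      ≤ W * 50 + 30 + (W * ((d + 1) * (250 * T)) + 8) := by gcongr
    _ ≤ W * 88 * 1 + W * ((d + 1) * (250 * T)) := by omega
    _ ≤ W * 88 * ((d + 1) * T) + W * ((d + 1) * (250 * T)) := by gcongr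
    _ = (d + 1) * (W * (338 * T)) := by ring
    _ ≤ (d + 1) * (W * (T ^ 9 * T)) := by
        gcongr
        exact le_trans (by norm_num) (Nat.pow_le_pow_left hT 9)
    _ = (d + 1) * T ^ (4 * K + 10) := by rw [pow_add]; ring

theorem four_mul_depth_add_ten_le (hz : 1 ≤ z) (hε₀ : 0 < ε) (hε₁ : ε < 1) :
    ((4 * depth z ε + 10 : ℕ) : ℝ) ≤ ((40000 : ℕ) : ℝ) ^ z / ε ^ 2 := by
  have hdepth : (depth z ε : ℝ) < 2304 * z ^ 2 / ε ^ 2 + 1 := Nat.ceil_lt_add_one (by positivity)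
  have hone : 1 ≤ (z : ℝ) ^ 2 / ε ^ 2 := by
    rw [one_le_div (by positivity)]
    have hz' : (1 : ℝ) ≤ z := by exact_mod_cast hz
    gcongr
    linarith
  have hsq : (z : ℝ) ^ 2 ≤ 4 ^ z := by
    have : (z : ℝ) ≤ 2 ^ z := by exact_mod_cast Nat.lt_two_pow_self.le
    calc (z : ℝ) ^ 2 ≤ (2 ^ z) ^ 2 := by gcongr
      _ = 4 ^ z := by rw [← pow_mul, mul_comm, pow_mul]; norm_num
  calc ((4 * depth z ε + 10 : ℕ) : ℝ)
      ≤ 10000 * ((z : ℝ) ^ 2 / ε ^ 2) := by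
        rw [mul_div_assoc] at hdepth
        push_cast
        linarith
    _ ≤ 10000 ^ z * (4 ^ z / ε ^ 2) := by
        gcongr
        exact le_self_pow₀ (by norm_num) (by omega)
    _ = ((40000 : ℕ) : ℝ) ^ z / ε ^ 2 := by rw [← mul_div_assoc, ← mul_pow]; norm_num

theorem natCast_pow_le_rpow (hT : 2 ≤ T) (hz : 1 ≤ z) (hε₀ : 0 < ε) (hε₁ : ε < 1) :
    ((T ^ (4 * depth z ε + 10) : ℕ) : ℝ) ≤ (T : ℝ) ^ (((40000 : ℕ) : ℝ) ^ z / ε ^ 2) := by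
  rw [Nat.cast_pow, ← Real.rpow_natCast]
  exact Real.rpow_le_rpow_of_exponent_le (by exact_mod_cast (by omega : 1 ≤ T))
    (four_mul_depth_add_ten_le hz hε₀ hε₁)

end Bounds

end Clustering

theorem mainTheorem9 :
    ∃ (prog : RealRAM.Prog) (A : ℕ),
      ∀ (T d z : ℕ) (ε : ℝ), 2 ≤ T → 1 ≤ z → 0 < ε → ε < 1 →
      ∀ (P : Multiset (Clustering.E d)) (L : List (Clustering.E d)),
        Clustering.IsListing L P → L.length ≤ T →
        ∃ (t : ℕ) (s : RealRAM.Mem),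
          RealRAM.Exec prog (Clustering.inputMem z ε L) t s ∧
          (t : ℝ) ≤ ((d : ℝ) + 1) * (T : ℝ) ^ ((A : ℝ) ^ z / ε ^ 2) ∧
          (Clustering.outputSet d s).Finite ∧
          ((Clustering.outputSet d s).ncard : ℝ) ≤ (T : ℝ) ^ ((A : ℝ) ^ z / ε ^ 2) ∧
          ∀ (m : ℕ) (Φ : Clustering.E d →ₗ[ℝ] Clustering.E m),
            Clustering.PreservesDist Φ (Clustering.outputSet d s) (ε / z) →
            ∀ P' : Multiset (Clustering.EExt d), Clustering.IsExtension P P' →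
            ∀ C' : Multiset (Clustering.EExt d), C' ≤ P' →
              (∃ c, Clustering.IsCenterZero z C' c) ∧
              (∃ c, Clustering.IsCenterZero z (Clustering.mapExt Φ C') c) ∧
              ∀ (c : Clustering.EExt d) (cΦ : Clustering.EExt m),
                Clustering.IsCenterZero z C' c →
                Clustering.IsCenterZero z (Clustering.mapExt Φ C') cΦ →
                (1 - 2 * ε) * Clustering.cost z C' c
                    ≤ Clustering.cost z (Clustering.mapExt Φ C') cΦ ∧
                Clustering.cost z (Clustering.mapExt Φ C') cΦ
                    ≤ (1 + 2 * ε) * Clustering.cost z C' c := by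
  refine ⟨Clustering.netProg, 40000, fun T d z ε hT hz hε₀ hε₁ P L hL hLT => ?_⟩
  obtain ⟨t, s, hexec, htime, hcount, hnet⟩ := Clustering.runs_netProg_inputMem hz hε₀ hε₁ L
  have hpow := Clustering.natCast_pow_le_rpow hT hz hε₀ hε₁
  refine ⟨t, s, hexec, ?_, Clustering.finite_outputSet d s, hpow.trans' ?_, ?_⟩
  · calc (t : ℝ) ≤ ((d + 1) * T ^ (4 * Clustering.depth z ε + 10) : ℕ) := by
          exact_mod_cast htime.trans (Clustering.time_le_mul_pow hT hLT)
      _ ≤ _ := by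
          rw [Nat.cast_mul, Nat.cast_succ]
          gcongr
  · have hcard := (Clustering.ncard_outputSet_le d s).trans_eq hcount
    exact_mod_cast (hcard.trans (Clustering.pow_le_pow_four_mul hT hLT)).trans
      (Nat.pow_le_pow_right (by omega) (by omega))
  · intro m Φ hΦ P' hP' C' hC'
    have hmem : ∀ x ∈ C', x.fst ∈ {p | p ∈ L} := fun x hx =>
      (hL.2 _).2 (hP' ▸ Multiset.mem_map_of_mem _ (Multiset.mem_of_le hC' hx))
    have hz' : z ≠ 0 := by omega
    exact ⟨Clustering.exists_isCenterZero hz' _, Clustering.exists_isCenterZero hz' _,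
      fun c cΦ hc hcΦ => Clustering.cost_preserved hz hε₀ hε₁ L.finite_toSet hnet hΦ hmem hc hcΦ⟩
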